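/- Let $(A_m)_{m\ge 0}$ be an Appell sequence, i.e. a sequence of real univariate polynomials with $A_0=1$ and $A_m'=m\,A_{m-1}$ for all $m\ge 1$. For a partition $\lambda=(\lambda_1\ge\lambda_2\ge\cdots\ge\lambda_r>0)$ let $(n_1,\dots,n_r)=(\lambda_r,\ \lambda_{r-1}+1,\ \dots,\ \lambda_1+r-1)$ and define the Wronskian Appell polynomial $$A_\lambda=\frac{\operatorname{Wr}[A_{n_1},A_{n_2},\dots,A_{n_r}]}{\prod_{1\le i<j\le r}(n_j-n_i)},$$ where $\operatorname{Wr}[f_1,\dots,f_r]=\det\big[f_i^{(j-1)}\big]_{1\le i,j\le r}$ is the Wronskian (so $A_\emptyset=1$). Let $F_\lambda$ be the number of standard Young tableaux of shape $\lambda$, i.e. of saturated chains $\emptyset=\nu^{(0)}\lessdot\nu^{(1)}\lessdot\cdots\lessdot\nu^{(|\lambda|)}=\lambda$ in Young's lattice (partitions ordered by inclusion of diagrams). Then for every $n\ge 0$ the weights $F_\lambda^2/n!$, $\lambda\vdash n$, define a probability measure on the partitions of $n$ (the Plancherel measure), i.e. $\sum_{\lambda\vdash n}F_\lambda^2/n!=1$,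 and the expected value of $A_\lambda$ with respect to it is $$\mathbb{E}(A_\lambda:\lambda\vdash n)=\sum_{\lambda\vdash n}\frac{F_\lambda^2}{n!}\,A_\lambda=A_1^n ,$$ where $A_1^n$ is the $n$-th power of the polynomial $A_1$. -/

import Mathlib

open Polynomial

/-- An Appell sequence: polynomials with `A₀ = 1` and `Aₙ' = n Aₙ₋₁` for all `n ≥ 1`. -/
structure IsAppellSequence (A : ℕ → ℝ[X]) : Prop where
  zero : A 0 = 1
  derivative_succ : ∀ n : ℕ, derivative (A (n + 1)) = ((n + 1 : ℕ) : ℝ[X]) * A n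

/-- The Wronskian `det [f_i^{(j)}]` of a finite list of polynomials (rows indexed by the
polynomials, columns by the order of the derivative). -/
noncomputable def polynomialWronskian {r : ℕ} (f : Fin r → ℝ[X]) : ℝ[X] :=
  (Matrix.of fun i j : Fin r => derivative^[(j : ℕ)] (f i)).det

/-- The length of a partition, i.e. the number of its nonzero parts. Partitions are identified
with their (Young) diagrams; the part `μ_{k+1}` is `μ.rowLen k`. -/
def partitionLength (μ : YoungDiagram) : ℕ := μ.colLen 0

/-- The degree vector `(μ_r, μ_{r-1} + 1, …, μ_1 + r - 1)` of a partition of length `r`,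
indexed from `0`. -/
def degreeVector (μ : YoungDiagram) (i : Fin (partitionLength μ)) : ℕ :=
  μ.rowLen (partitionLength μ - 1 - (i : ℕ)) + (i : ℕ)

/-- The Wronskian Appell polynomial
`A_μ = Wr[A_{n_1}, …, A_{n_r}] / Δ(n_1, …, n_r)`, where `(n_1, …, n_r)` is the degree vector
of `μ` and `Δ` is the Vandermonde determinant. -/
noncomputable def wronskianAppell (A : ℕ → ℝ[X]) (μ : YoungDiagram) : ℝ[X] :=
  C ((Matrix.vandermonde fun i => (degreeVector μ i : ℝ)).det)⁻¹ *
    polynomialWronskian fun i => A (degreeVector μ i)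

/-- The standard Young tableaux of shape `μ`, as saturated chains
`∅ = ν₀ ⋖ ν₁ ⋖ ⋯ ⋖ ν_m = μ` (`m = |μ|`) in Young's lattice. -/
def standardTableaux (μ : YoungDiagram) : Set (Fin (μ.card + 1) → YoungDiagram) :=
  {ν | ν 0 = ⊥ ∧ ν (Fin.last μ.card) = μ ∧
    ∀ i : Fin μ.card, ν i.castSucc < ν i.succ ∧ (ν i.succ).card = (ν i.castSucc).card + 1}

/-- `F_μ`, the number of standard Young tableaux of shape `μ`. -/
noncomputable def numStandardTableaux (μ : YoungDiagram) : ℕ := (standardTableaux μ).ncard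

theorem finite_setOf_card_eq (n : ℕ) : {μ : YoungDiagram | μ.card = n}.Finite := by
  refine Set.Finite.of_finite_image (f := YoungDiagram.cells) ?_
    (fun μ _ ν _ h => YoungDiagram.ext h)
  refine (Finset.finite_toSet (Finset.range n ×ˢ Finset.range n).powerset).subset ?_
  rintro _ ⟨μ, rfl, rfl⟩
  simp only [Finset.coe_powerset, Set.mem_preimage, Set.mem_powerset_iff, Finset.coe_subset]
  rintro ⟨i, j⟩ h
  rw [YoungDiagram.mem_cells] at h
  simp only [Finset.mem_product, Finset.mem_range]
  constructor
  · refine (YoungDiagram.mem_iff_lt_colLen.1 h).trans_le ?_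
    rw [YoungDiagram.colLen_eq_card]
    exact Finset.card_le_card (Finset.filter_subset _ _)
  · refine (YoungDiagram.mem_iff_lt_rowLen.1 h).trans_le ?_
    rw [YoungDiagram.rowLen_eq_card]
    exact Finset.card_le_card (Finset.filter_subset _ _)

/-- The finite set of all partitions of `n`. -/
noncomputable def partitionsOf (n : ℕ) : Finset YoungDiagram :=
  (finite_setOf_card_eq n).toFinset

theorem mem_partitionsOf {n : ℕ} {μ : YoungDiagram} : μ ∈ partitionsOf n ↔ μ.card = n := by
  simp [partitionsOf]

/-- The Plancherel weight `F_μ² / n!` of a partition `μ` of `n`. -/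
noncomputable def plancherelWeight (n : ℕ) (μ : YoungDiagram) : ℝ :=
  (numStandardTableaux μ : ℝ) ^ 2 / (n.factorial : ℝ)

/-- The expected value of a polynomial-valued random variable on the partitions of `n` with
respect to the Plancherel measure. -/
noncomputable def plancherelExpectation (n : ℕ) (f : YoungDiagram → ℝ[X]) : ℝ[X] :=
  ∑ μ ∈ partitionsOf n, C (plancherelWeight n μ) * f μ

/-!
Wronskian Appell polynomials are rescaled Schur functions, and the Plancherel weight absorbs the
scaling, which turns the expectation into the classical expansion of `h_1 ^ n`.

In detail, let `s_μ(H) = det [H (μ_k - k + j)]` be the Schur function of `μ` at the specialization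
`h_m = H m` of the complete homogeneous symmetric functions (`schurValue`). Differentiating
`A_n` gives `A_n^{(j)} = n! · A_{n-j} / (n-j)!`, so the Wronskian of `μ` is
`∏ n_i! · s_μ(A_m / m!)`. For the same reason, with falling factorials instead of derivatives, the
Vandermonde determinant is `∏ n_i! · s_μ(1 / m!)` (`det_vandermonde_degreeVector`). Therefore
`s_μ(1 / m!) · A_μ = s_μ(A_m / m!)` (`IsAppellSequence.C_mul_wronskianAppell`). By Frobenius'
formula `F_μ = n! · s_μ(1 / m!)` (`numStandardTableaux_eq_factorial_mul`), the average of `A_μ` is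
`∑ F_μ s_μ(A_m / m!)` and the total mass of the Plancherel measure is `∑ F_μ s_μ(1 / m!)`. Both are
evaluated by `∑ F_μ s_μ(H) = (H 1) ^ n` (`sum_numStandardTableaux_mul_schurValue`).

This last identity and Frobenius' formula follow by induction from the recursion
`F_μ = ∑_{ν ⋖ μ} F_ν` and from two branching rules: the Pieri rule
`∑_{μ ⋗ ν} s_μ(H) = H 1 · s_ν(H)` and, for `H m = 1 / m!`, the lowering rule
`∑_{ν ⋖ μ} s_ν(H) = |μ| · s_μ(H)`. In both rules the sum over diagrams is the sum over the rows `k`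
of the determinant in which `μ_k` is changed by one; rows that admit no box to be added or removed
give a determinant with two equal rows or a zero row. Replacing rows one at a time has the same
total effect as replacing columns one at a time (`sum_det_updateRow_eq_sum_det_updateCol`), and
there nearly all terms are trivial.
-/

/-! ### Determinants of Jacobi–Trudi type -/

section Determinants

variable {R : Type*} [CommRing R]

/-- Both sides are the derivative at `t = 0` of `det (M + t N)`. -/
theorem sum_det_updateRow_eq_sum_det_updateCol {n : Type*} [Fintype n] [DecidableEq n]
    (M N : Matrix n n R) :
    ∑ i, (M.updateRow i (N i)).det = ∑ j, (M.updateCol j fun i => N i j).det := by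
  have hrow (i : n) : (M.updateRow i (N i)).det = ∑ j, N i j * M.adjugate j i := by
    rw [← Matrix.cramer_transpose_apply, Matrix.cramer_eq_adjugate_mulVec,
      ← Matrix.adjugate_transpose]
    simp [Matrix.mulVec, dotProduct, mul_comm]
  have hcol (j : n) : (M.updateCol j fun i => N i j).det = ∑ i, N i j * M.adjugate j i := by
    rw [← Matrix.cramer_apply, Matrix.cramer_eq_adjugate_mulVec]
    simp [Matrix.mulVec, dotProduct, mul_comm]
  simp_rw [hrow, hcol]
  exact Finset.sum_comm

/-- Rescaling the entries of one row at a time, by factors `x i + y j`. -/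
theorem sum_det_updateRow_add_mul {n : Type*} [Fintype n] [DecidableEq n]
    (M : Matrix n n R) (x y : n → R) :
    ∑ i, (M.updateRow i fun j => (x i + y j) * M i j).det = (∑ i, x i + ∑ j, y j) * M.det := by
  have hx (i : n) : (M.updateRow i fun j => x i * M i j).det = x i * M.det := by
    have h := Matrix.det_updateRow_smul M i (x i) (M i)
    rw [Matrix.updateRow_eq_self] at h
    exact h
  have hy (j : n) : (M.updateCol j fun i => y j * M i j).det = y j * M.det := by
    have h := Matrix.det_updateCol_smul M j (y j) (fun i => M i j)
    rw [show M.updateCol j (fun i => M i j) = M from Matrix.updateCol_eq_self M j] at h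
    exact h
  have hsplit (i : n) : (M.updateRow i fun j => (x i + y j) * M i j).det =
      (M.updateRow i fun j => x i * M i j).det + (M.updateRow i fun j => y j * M i j).det := by
    rw [← Matrix.det_updateRow_add]
    congr 2
    funext j
    simp [add_mul]
  have hcols := sum_det_updateRow_eq_sum_det_updateCol M (Matrix.of fun i j => y j * M i j)
  simp only [Matrix.of_apply] at hcols
  have hcols' : ∑ i, (M.updateRow i fun j => y j * M i j).det = ∑ j, y j * M.det :=
    hcols.trans (Finset.sum_congr rfl fun j _ => hy j)
  simp_rw [hsplit, Finset.sum_add_distrib, hx, hcols', ← Finset.sum_mul, ← add_mul]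

/-- The Jacobi–Trudi determinant `det [H (a_k - k + j)]` of size `N`, with rows and columns
indexed from `0`. Only the first `N` values of `a` matter. -/
def jacobiTrudi (H : ℤ → R) (N : ℕ) (a : ℕ → ℤ) : R :=
  (Matrix.of fun k j : Fin N => H (a k - k + j)).det

theorem jacobiTrudi_update (H : ℤ → R) {N : ℕ} (a : ℕ → ℤ) (i : Fin N) (x : ℤ) :
    jacobiTrudi H N (Function.update a i x) =
      ((Matrix.of fun k j : Fin N => H (a k - k + j)).updateRow i
        fun j : Fin N => H (x - i + j)).det := by
  unfold jacobiTrudi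
  congr 1
  ext k j
  rcases eq_or_ne k i with rfl | hk
  · simp
  · simp [Matrix.updateRow_ne hk, Function.update_of_ne (Fin.val_injective.ne hk)]

theorem jacobiTrudi_eq_zero_of_row_eq (H : ℤ → R) {N : ℕ} {a : ℕ → ℤ} {k l : ℕ} (hk : k < N)
    (hl : l < N) (hkl : k ≠ l) (h : a k - k = a l - l) : jacobiTrudi H N a = 0 := by
  refine Matrix.det_zero_of_row_eq (i := ⟨k, hk⟩) (j := ⟨l, hl⟩) (by simpa using hkl) ?_
  funext j
  simp [h]

theorem jacobiTrudi_eq_zero_of_row_neg {H : ℤ → R} (hneg : ∀ m < 0, H m = 0) {N : ℕ}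
    {a : ℕ → ℤ} {k : ℕ} (hk : k < N) (h : a k - k + N ≤ 0) : jacobiTrudi H N a = 0 := by
  refine Matrix.det_eq_zero_of_row_eq_zero ⟨k, hk⟩ fun j => ?_
  rw [Matrix.of_apply]
  apply hneg
  have := j.2
  simp only
  omega

/-- If the last row of a matrix vanishes off the diagonal, expand along it. -/
theorem det_succ_of_last_row {N : ℕ} (M : Matrix (Fin (N + 1)) (Fin (N + 1)) R)
    (h : ∀ j : Fin N, M (Fin.last N) j.castSucc = 0) :
    M.det = M (Fin.last N) (Fin.last N) * (M.submatrix Fin.castSucc Fin.castSucc).det := by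
  rw [Matrix.det_succ_row M (Fin.last N), Fin.sum_univ_castSucc]
  simp [h, Fin.succAbove_last, ← two_mul]

theorem jacobiTrudi_succ {H : ℤ → R} (hneg : ∀ m < 0, H m = 0) (hzero : H 0 = 1) {N : ℕ}
    {a : ℕ → ℤ} (ha : a N = 0) : jacobiTrudi H (N + 1) a = jacobiTrudi H N a := by
  rw [jacobiTrudi, det_succ_of_last_row]
  · simp [ha, hzero, jacobiTrudi, Matrix.submatrix]
  · intro j
    have := j.2
    simp only [Matrix.of_apply, Fin.val_last, Fin.val_castSucc, ha]
    exact hneg _ (by omega)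

theorem jacobiTrudi_eq_of_le {H : ℤ → R} (hneg : ∀ m < 0, H m = 0) (hzero : H 0 = 1) {M N : ℕ}
    (hMN : M ≤ N) {a : ℕ → ℤ} (ha : ∀ k, M ≤ k → a k = 0) :
    jacobiTrudi H N a = jacobiTrudi H M a := by
  induction N, hMN using Nat.le_induction with
  | base => rfl
  | succ N hN ih => rw [jacobiTrudi_succ hneg hzero (ha N hN), ih]

/-- The Pieri rule for multiplication by `H 1`, before discarding the degenerate terms: raising
the arguments row by row amounts to raising them column by column, and all columns but the last
then repeat their right neighbour. -/
theorem sum_jacobiTrudi_raise {H : ℤ → R} (hneg : ∀ m < 0, H m = 0) {N : ℕ}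
    {a : ℕ → ℤ} (ha : a N = 0) :
    ∑ k ∈ Finset.range (N + 1), jacobiTrudi H (N + 1) (Function.update a k (a k + 1)) =
      H 1 * jacobiTrudi H N a := by
  set M : Matrix (Fin (N + 1)) (Fin (N + 1)) R := Matrix.of fun k j => H (a k - k + j) with hM
  have hcols := sum_det_updateRow_eq_sum_det_updateCol M
    (Matrix.of fun k j => H (a k + 1 - k + j))
  rw [Finset.sum_range]
  simp_rw [jacobiTrudi_update]
  refine hcols.trans ?_
  rw [Fin.sum_univ_castSucc, Finset.sum_eq_zero, zero_add, det_succ_of_last_row]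
  · congr 1
    · simp [ha]
    · unfold jacobiTrudi
      congr 1
      ext k j
      simp [hM]
  · intro j
    have := j.2
    rw [Matrix.updateCol_ne (Fin.castSucc_lt_last j).ne, hM, Matrix.of_apply]
    simp only [Fin.val_last, Fin.val_castSucc, ha]
    exact hneg _ (by omega)
  · intro j _
    refine Matrix.det_zero_of_column_eq (i := j.castSucc) (j := j.succ)
      (Fin.castSucc_lt_succ).ne fun k => ?_
    rw [Matrix.updateCol_self, Matrix.updateCol_ne (Fin.castSucc_lt_succ).ne']
    simp only [hM, Matrix.of_apply, Fin.val_castSucc, Fin.val_succ]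
    congr 1
    push_cast
    ring

/-- The relation `H (m - 1) = m * H m` is that of `H m = 1 / m!`. -/
theorem sum_jacobiTrudi_lower {H : ℤ → R} (hH : ∀ m : ℤ, H (m - 1) = m * H m) (N : ℕ)
    (a : ℕ → ℤ) :
    ∑ k ∈ Finset.range N, jacobiTrudi H N (Function.update a k (a k - 1)) =
      ((∑ k ∈ Finset.range N, a k : ℤ) : R) * jacobiTrudi H N a := by
  have h := sum_det_updateRow_add_mul (Matrix.of fun k j : Fin N => H (a k - k + j))
    (fun k : Fin N => ((a k - k : ℤ) : R)) (fun j : Fin N => ((j : ℕ) : R))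
  rw [Finset.sum_range, Finset.sum_range]
  simp_rw [jacobiTrudi_update]
  have hrow (k j : Fin N) :
      H (a k - 1 - k + j) = ((a k - k : ℤ) + ((j : ℕ) : R)) * H (a k - k + j) := by
    rw [show a k - 1 - k + j = (a k - k + j) - 1 by ring, hH]
    push_cast
    rfl
  simp_rw [hrow]
  refine h.trans ?_
  simp [Finset.sum_sub_distrib, jacobiTrudi]

end Determinants

/-! ### Adding and removing boxes of Young diagrams -/

namespace YoungDiagram

theorem ext_rowLen {μ ν : YoungDiagram} (h : ∀ k, μ.rowLen k = ν.rowLen k) : μ = ν := by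
  refine YoungDiagram.ext (Finset.ext ?_)
  rintro ⟨i, j⟩
  rw [mem_cells, mem_cells, mem_iff_lt_rowLen, mem_iff_lt_rowLen, h]

theorem rowLen_mono {μ ν : YoungDiagram} (h : μ ≤ ν) (k : ℕ) : μ.rowLen k ≤ ν.rowLen k := by
  by_contra! hk
  have hmem : (k, ν.rowLen k) ∈ ν := h (mem_iff_lt_rowLen.2 hk)
  exact lt_irrefl _ (mem_iff_lt_rowLen.1 hmem)

theorem le_of_rowLen_le {μ ν : YoungDiagram} (h : ∀ k, μ.rowLen k ≤ ν.rowLen k) : μ ≤ ν := by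
  rintro ⟨i, j⟩ hij
  exact mem_iff_lt_rowLen.2 ((mem_iff_lt_rowLen.1 hij).trans_le (h i))

theorem rowLen_eq_zero {μ : YoungDiagram} {k : ℕ} (h : partitionLength μ ≤ k) :
    μ.rowLen k = 0 := by
  by_contra! hk
  have hmem : (k, 0) ∈ μ := mem_iff_lt_rowLen.2 (Nat.pos_of_ne_zero hk)
  exact absurd (mem_iff_lt_colLen.1 hmem) (not_lt.2 h)

theorem partitionLength_le_card (μ : YoungDiagram) : partitionLength μ ≤ μ.card := by
  rw [partitionLength, colLen_eq_card]
  exact Finset.card_le_card (Finset.filter_subset _ _)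

theorem card_eq_sum_rowLen {μ : YoungDiagram} {N : ℕ} (h : partitionLength μ ≤ N) :
    μ.card = ∑ k ∈ Finset.range N, μ.rowLen k := by
  have hmaps : ∀ c ∈ μ.cells, c.1 ∈ Finset.range N := by
    rintro ⟨i, j⟩ hij
    rw [mem_cells] at hij
    exact Finset.mem_range.2 ((mem_iff_lt_colLen.1 (μ.up_left_mem le_rfl (Nat.zero_le j)
      hij)).trans_le h)
  rw [show μ.card = μ.cells.card from rfl, Finset.card_eq_sum_card_fiberwise hmaps]
  exact Finset.sum_congr rfl fun k _ => (μ.rowLen_eq_card).symm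

/-- The row lengths of a Young diagram can be prescribed: any antitone sequence that is
eventually zero occurs. -/
theorem exists_rowLen_eq {f : ℕ → ℕ} (hf : Antitone f) {N : ℕ} (hN : f N = 0) :
    ∃ μ : YoungDiagram, ∀ k, μ.rowLen k = f k := by
  let c : Finset (ℕ × ℕ) := (Finset.range N ×ˢ Finset.range (f 0)).filter fun c => c.2 < f c.1
  have hc (i j : ℕ) : (i, j) ∈ c ↔ j < f i := by
    simp only [c, Finset.mem_filter, Finset.mem_product, Finset.mem_range, and_iff_right_iff_imp]
    refine fun h => ⟨?_, h.trans_le (hf (Nat.zero_le i))⟩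
    by_contra! hi
    have := hf hi
    omega
  refine ⟨⟨c, ?_⟩, fun k => ?_⟩
  · rintro ⟨i, j⟩ ⟨i', j'⟩ hle hij
    obtain ⟨hi, hj⟩ := Prod.mk_le_mk.1 hle
    have hij' := (hc i j).1 hij
    exact (hc i' j').2 ((hj.trans_lt hij').trans_le (hf hi))
  · refine le_antisymm (le_of_forall_lt fun j hj => ?_) (le_of_forall_lt fun j hj => ?_)
    · exact (hc k j).1 (mem_iff_lt_rowLen.2 hj)
    · exact mem_iff_lt_rowLen.1 ((hc k j).2 hj : (k, j) ∈ YoungDiagram.mk c _)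

/-- `μ` arises from `ν` by adding one box at the end of row `k`. -/
def AddsBox (ν μ : YoungDiagram) (k : ℕ) : Prop :=
  ∀ j, μ.rowLen j = ν.rowLen j + if j = k then 1 else 0

namespace AddsBox

variable {ν μ : YoungDiagram} {k : ℕ}

theorem lt_partitionLength (h : AddsBox ν μ k) : k < partitionLength μ := by
  by_contra! hk
  have := h k
  rw [rowLen_eq_zero hk] at this
  simp at this

theorem lt (h : AddsBox ν μ k) : ν < μ := by
  refine lt_of_le_of_ne (le_of_rowLen_le fun j => (h j).symm ▸ Nat.le_add_right _ _) ?_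
  rintro rfl
  simpa using h k

theorem card_eq (h : AddsBox ν μ k) : μ.card = ν.card + 1 := by
  have hν : partitionLength ν ≤ max (partitionLength ν) (partitionLength μ) := le_max_left _ _
  have hμ : partitionLength μ ≤ max (partitionLength ν) (partitionLength μ) := le_max_right _ _
  rw [card_eq_sum_rowLen hν, card_eq_sum_rowLen hμ, Finset.sum_congr rfl fun j _ => h j,
    Finset.sum_add_distrib, Finset.sum_ite_eq', if_pos]
  exact Finset.mem_range.2 (h.lt_partitionLength.trans_le hμ)

theorem row_unique {l : ℕ} (hk : AddsBox ν μ k) (hl : AddsBox ν μ l) : k = l := by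
  have h := hk k
  rw [hl k] at h
  by_contra! hne
  simp [hne] at h

theorem right_unique {μ' : YoungDiagram} (h : AddsBox ν μ k) (h' : AddsBox ν μ' k) : μ = μ' :=
  ext_rowLen fun j => by rw [h j, h' j]

theorem left_unique {ν' : YoungDiagram} (h : AddsBox ν μ k) (h' : AddsBox ν' μ k) : ν = ν' :=
  ext_rowLen fun j => Nat.add_right_cancel ((h j).symm.trans (h' j))

theorem cast_rowLen_eq_update_add (h : AddsBox ν μ k) :
    (fun j => (μ.rowLen j : ℤ)) =
      Function.update (fun j => (ν.rowLen j : ℤ)) k ((ν.rowLen k : ℤ) + 1) := by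
  funext j
  rcases eq_or_ne j k with rfl | hj
  · simp [h j]
  · simp [h j, hj]

theorem cast_rowLen_eq_update_sub (h : AddsBox ν μ k) :
    (fun j => (ν.rowLen j : ℤ)) =
      Function.update (fun j => (μ.rowLen j : ℤ)) k ((μ.rowLen k : ℤ) - 1) := by
  funext j
  rcases eq_or_ne j k with rfl | hj
  · simp [h j]
  · simp [h j, hj]

end AddsBox

/-- A strict inclusion of diagrams whose sizes differ by one adds a single box. -/
theorem exists_addsBox_of_lt {ν μ : YoungDiagram} (hlt : ν < μ) (hcard : μ.card = ν.card + 1) :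
    ∃ k, AddsBox ν μ k := by
  have hle := rowLen_mono hlt.le
  set N := max (partitionLength ν) (partitionLength μ)
  have hν : partitionLength ν ≤ N := le_max_left _ _
  have hμ : partitionLength μ ≤ N := le_max_right _ _
  have hsum : ∑ k ∈ Finset.range N, (μ.rowLen k - ν.rowLen k) = 1 := by
    rw [Finset.sum_tsub_distrib _ fun k _ => hle k, ← card_eq_sum_rowLen hν,
      ← card_eq_sum_rowLen hμ]
    omega
  obtain ⟨k, hk, hne⟩ := Finset.exists_ne_zero_of_sum_ne_zero (hsum.trans_ne one_ne_zero)
  refine ⟨k, fun j => ?_⟩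
  rw [← Finset.add_sum_erase _ _ hk] at hsum
  have hrest : ∑ x ∈ (Finset.range N).erase k, (μ.rowLen x - ν.rowLen x) = 0 := by omega
  rw [Finset.sum_eq_zero_iff] at hrest
  have hlej := hle j
  split_ifs with hj
  · subst hj
    omega
  · by_cases hjN : j < N
    · have := hrest j (Finset.mem_erase.2 ⟨hj, Finset.mem_range.2 hjN⟩)
      omega
    · rw [rowLen_eq_zero (hν.trans (not_lt.1 hjN)), rowLen_eq_zero (hμ.trans (not_lt.1 hjN))]

theorem exists_addsBox_right {ν : YoungDiagram} {k : ℕ}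
    (hk : ∀ j < k, ν.rowLen k < ν.rowLen j) : ∃ μ, AddsBox ν μ k := by
  have hanti : Antitone fun j => ν.rowLen j + if j = k then 1 else 0 := by
    intro i j hij
    have hle := ν.rowLen_anti i j hij
    rcases eq_or_ne j k with rfl | hj
    · rcases hij.eq_or_lt with rfl | hij
      · exact le_rfl
      · have := hk i hij
        simp [hij.ne]
        omega
    · simp only [hj, if_false]
      omega
  refine exists_rowLen_eq hanti (N := max (partitionLength ν) (k + 1)) ?_
  have hlt : k < max (partitionLength ν) (k + 1) := lt_max_of_lt_right k.lt_succ_self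
  simp only [hlt.ne', if_false, rowLen_eq_zero (le_max_left _ _)]

theorem exists_addsBox_left {μ : YoungDiagram} {k : ℕ}
    (hk : μ.rowLen (k + 1) < μ.rowLen k) : ∃ ν, AddsBox ν μ k := by
  have hanti : Antitone fun j => μ.rowLen j - if j = k then 1 else 0 := by
    refine antitone_nat_of_succ_le fun j => ?_
    have hle := μ.rowLen_anti j (j + 1) j.le_succ
    rcases eq_or_ne j k with rfl | hj
    · simp
      omega
    · simp only [hj, if_false]
      omega
  obtain ⟨ν, hν⟩ := exists_rowLen_eq hanti (N := partitionLength μ)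
    (by simp [rowLen_eq_zero le_rfl])
  refine ⟨ν, fun j => ?_⟩
  rw [hν]
  split_ifs with hj
  · subst hj
    omega
  · omega

end YoungDiagram

open YoungDiagram

open scoped Classical in
/-- A sum over the diagrams covering `ν` is a sum over rows, provided the rows that cannot be
extended contribute nothing. -/
theorem sum_covers_eq_sum_rows {R : Type*} [AddCommMonoid R] {ν : YoungDiagram} {n N : ℕ}
    (hν : ν.card = n) (hN : n + 1 ≤ N) (f : YoungDiagram → R) (g : ℕ → R)
    (hfg : ∀ μ k, AddsBox ν μ k → f μ = g k)
    (hg : ∀ k < N, (¬ ∃ μ, AddsBox ν μ k) → g k = 0) :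
    ∑ μ ∈ partitionsOf (n + 1) with ν < μ, f μ = ∑ k ∈ Finset.range N, g k := by
  symm
  refine Finset.sum_bij_ne_zero
    (fun k hk hne => (not_imp_comm.1 (hg k (Finset.mem_range.1 hk)) hne).choose) ?_ ?_ ?_ ?_
  · intro k hk hne
    have h := (not_imp_comm.1 (hg k (Finset.mem_range.1 hk)) hne).choose_spec
    rw [Finset.mem_filter, mem_partitionsOf]
    exact ⟨by rw [h.card_eq, hν], h.lt⟩
  · intro k hk hne l hl hne' heq
    have h := (not_imp_comm.1 (hg k (Finset.mem_range.1 hk)) hne).choose_spec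
    have h' := (not_imp_comm.1 (hg l (Finset.mem_range.1 hl)) hne').choose_spec
    rw [← heq] at h'
    exact h.row_unique h'
  · intro μ hμ hne
    rw [Finset.mem_filter, mem_partitionsOf] at hμ
    obtain ⟨k, hk⟩ := exists_addsBox_of_lt hμ.2 (by rw [hμ.1, hν])
    have hkN : k ∈ Finset.range N := Finset.mem_range.2
      (hk.lt_partitionLength.trans_le ((partitionLength_le_card μ).trans (hμ.1.trans_le hN)))
    have hne' : g k ≠ 0 := hfg μ k hk ▸ hne
    have h := (not_imp_comm.1 (hg k (Finset.mem_range.1 hkN)) hne').choose_spec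
    exact ⟨k, hkN, hne', h.right_unique hk⟩
  · intro k hk hne
    exact (hfg _ k (not_imp_comm.1 (hg k (Finset.mem_range.1 hk)) hne).choose_spec).symm

open scoped Classical in
/-- A sum over the diagrams covered by `μ` is a sum over rows, provided the rows that cannot be
shortened contribute nothing. -/
theorem sum_coveredBy_eq_sum_rows {R : Type*} [AddCommMonoid R] {μ : YoungDiagram} {n N : ℕ}
    (hμ : μ.card = n + 1) (hN : partitionLength μ ≤ N) (f : YoungDiagram → R) (g : ℕ → R)
    (hfg : ∀ ν k, AddsBox ν μ k → f ν = g k)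
    (hg : ∀ k < N, (¬ ∃ ν, AddsBox ν μ k) → g k = 0) :
    ∑ ν ∈ partitionsOf n with ν < μ, f ν = ∑ k ∈ Finset.range N, g k := by
  symm
  refine Finset.sum_bij_ne_zero
    (fun k hk hne => (not_imp_comm.1 (hg k (Finset.mem_range.1 hk)) hne).choose) ?_ ?_ ?_ ?_
  · intro k hk hne
    have h := (not_imp_comm.1 (hg k (Finset.mem_range.1 hk)) hne).choose_spec
    rw [Finset.mem_filter, mem_partitionsOf]
    exact ⟨Nat.add_right_cancel (h.card_eq.symm.trans hμ), h.lt⟩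
  · intro k hk hne l hl hne' heq
    have h := (not_imp_comm.1 (hg k (Finset.mem_range.1 hk)) hne).choose_spec
    have h' := (not_imp_comm.1 (hg l (Finset.mem_range.1 hl)) hne').choose_spec
    rw [← heq] at h'
    exact h.row_unique h'
  · intro ν hν hne
    rw [Finset.mem_filter, mem_partitionsOf] at hν
    obtain ⟨k, hk⟩ := exists_addsBox_of_lt hν.2 (by rw [hν.1, hμ])
    have hkN : k ∈ Finset.range N := Finset.mem_range.2 (hk.lt_partitionLength.trans_le hN)
    have hne' : g k ≠ 0 := hfg ν k hk ▸ hne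
    have h := (not_imp_comm.1 (hg k (Finset.mem_range.1 hkN)) hne').choose_spec
    exact ⟨k, hkN, hne', h.left_unique hk⟩
  · intro k hk hne
    exact (hfg _ k (not_imp_comm.1 (hg k (Finset.mem_range.1 hk)) hne).choose_spec).symm

/-! ### Schur functions and their branching rules -/

section Schur

variable {R : Type*} [CommRing R]

/-- The Schur function of `μ` in the Jacobi–Trudi form `det [h_{μ_k - k + j}]`, evaluated at the
specialization of the complete homogeneous symmetric functions `h_m` to `H m`. -/
def schurValue (H : ℤ → R) (μ : YoungDiagram) : R :=
  jacobiTrudi H (partitionLength μ) fun k => (μ.rowLen k : ℤ)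

theorem jacobiTrudi_rowLen {H : ℤ → R} (hneg : ∀ m < 0, H m = 0) (hzero : H 0 = 1)
    {μ : YoungDiagram} {N : ℕ} (hN : partitionLength μ ≤ N) :
    jacobiTrudi H N (fun k => (μ.rowLen k : ℤ)) = schurValue H μ :=
  jacobiTrudi_eq_of_le hneg hzero hN fun _ hk => by rw [rowLen_eq_zero hk, Nat.cast_zero]

open scoped Classical in
/-- The Pieri rule for multiplication by `h_1`. -/
theorem sum_schurValue_covers {H : ℤ → R} (hneg : ∀ m < 0, H m = 0) (hzero : H 0 = 1)
    {ν : YoungDiagram} {n : ℕ} (hν : ν.card = n) :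
    ∑ μ ∈ partitionsOf (n + 1) with ν < μ, schurValue H μ = H 1 * schurValue H ν := by
  have hlen : partitionLength ν ≤ n := hν ▸ partitionLength_le_card ν
  rw [← jacobiTrudi_rowLen hneg hzero hlen, ← sum_jacobiTrudi_raise hneg
    (by rw [rowLen_eq_zero hlen, Nat.cast_zero])]
  refine sum_covers_eq_sum_rows hν le_rfl _ _ (fun μ k h => ?_) (fun k hk h => ?_)
  · rw [← h.cast_rowLen_eq_update_add, jacobiTrudi_rowLen hneg hzero]
    exact (partitionLength_le_card μ).trans (h.card_eq.trans (by rw [hν])).le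
  · -- Row `k` is as long as some earlier row, hence as row `k - 1`: two rows coincide.
    have hex : ∃ j < k, ν.rowLen j ≤ ν.rowLen k := by
      by_contra! hcon
      exact h (exists_addsBox_right hcon)
    obtain ⟨j, hj, hle⟩ := hex
    have h₁ := ν.rowLen_anti j (k - 1) (by omega)
    have h₂ := ν.rowLen_anti (k - 1) k (by omega)
    refine jacobiTrudi_eq_zero_of_row_eq H hk (l := k - 1) (by omega) (by omega) ?_
    rw [Function.update_self, Function.update_of_ne (by omega)]
    omega

open scoped Classical in
/-- The lowering rule, dual to the Pieri rule, for the specialization `H m = 1 / m!`. -/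
theorem sum_schurValue_coveredBy {H : ℤ → R} (hneg : ∀ m < 0, H m = 0) (hzero : H 0 = 1)
    (hH : ∀ m : ℤ, H (m - 1) = m * H m) {μ : YoungDiagram} {n : ℕ} (hμ : μ.card = n + 1) :
    ∑ ν ∈ partitionsOf n with ν < μ, schurValue H ν = (n + 1 : ℕ) * schurValue H μ := by
  have hsum := sum_jacobiTrudi_lower hH (partitionLength μ) fun k => (μ.rowLen k : ℤ)
  rw [← Nat.cast_sum, ← card_eq_sum_rowLen le_rfl, hμ, Int.cast_natCast] at hsum
  refine Eq.trans ?_ hsum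
  refine sum_coveredBy_eq_sum_rows hμ le_rfl _ _ (fun ν k h => ?_) (fun k hk h => ?_)
  · rw [← h.cast_rowLen_eq_update_sub, jacobiTrudi_rowLen hneg hzero]
    by_contra! hlt
    have hpos : 0 < ν.rowLen (partitionLength μ) :=
      mem_iff_lt_rowLen.1 (mem_iff_lt_colLen.2 hlt)
    have := h (partitionLength μ)
    rw [rowLen_eq_zero le_rfl] at this
    omega
  · -- Row `k` is as long as row `k + 1`: the two rows coincide after lowering, unless `k` is the
    -- last row, which then vanishes.
    have hle : μ.rowLen k ≤ μ.rowLen (k + 1) := by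
      by_contra! hcon
      exact h (exists_addsBox_left hcon)
    have hanti := μ.rowLen_anti k (k + 1) k.le_succ
    rcases Nat.lt_or_ge (k + 1) (partitionLength μ) with hk' | hk'
    · refine jacobiTrudi_eq_zero_of_row_eq H hk hk' (by omega) ?_
      rw [Function.update_self, Function.update_of_ne (by omega)]
      push_cast
      omega
    · rw [rowLen_eq_zero hk'] at hle
      refine jacobiTrudi_eq_zero_of_row_neg hneg hk ?_
      rw [Function.update_self]
      omega

theorem schurValue_of_card_eq_zero (H : ℤ → R) {μ : YoungDiagram} (h : μ.card = 0) :
    schurValue H μ = 1 := by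
  have hlen : partitionLength μ = 0 := Nat.le_zero.1 (h ▸ partitionLength_le_card μ)
  unfold schurValue
  rw [hlen, jacobiTrudi, Matrix.det_isEmpty]

end Schur

/-! ### Counting standard Young tableaux -/

section Tableaux

/-- The saturated chains `∅ = ν₀ ⋖ ⋯ ⋖ ν_m = μ` with a length `m` that is not tied to `|μ|`
(there are none unless `m = |μ|`), so that chains of length `m + 1` restrict to chains of
length `m` without transport along equalities of cardinalities. -/
def saturatedChains (m : ℕ) (μ : YoungDiagram) : Set (Fin (m + 1) → YoungDiagram) :=
  {ν | ν 0 = ⊥ ∧ ν (Fin.last m) = μ ∧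
    ∀ i : Fin m, ν i.castSucc < ν i.succ ∧ (ν i.succ).card = (ν i.castSucc).card + 1}

theorem numStandardTableaux_eq_ncard {μ : YoungDiagram} {m : ℕ} (hμ : μ.card = m) :
    numStandardTableaux μ = (saturatedChains m μ).ncard := by
  subst hμ
  rfl

open scoped Classical in
theorem saturatedChains_succ {μ : YoungDiagram} {m : ℕ} (hμ : μ.card = m + 1) :
    saturatedChains (m + 1) μ = ⋃ ν ∈ (partitionsOf m).filter (· < μ),
      (fun c : Fin (m + 1) → YoungDiagram => (Fin.snoc c μ : Fin (m + 2) → YoungDiagram)) ''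
        saturatedChains m ν := by
  ext c
  simp only [Set.mem_iUnion, Set.mem_image, Finset.mem_filter, mem_partitionsOf, exists_prop]
  constructor
  · rintro ⟨h0, hlast, hstep⟩
    refine ⟨c (Fin.last m).castSucc, ⟨?_, ?_⟩, Fin.init c, ⟨h0, rfl, fun i => ?_⟩, ?_⟩
    · have h := (hstep (Fin.last m)).2
      rw [Fin.succ_last, hlast, hμ] at h
      exact (Nat.add_right_cancel h).symm
    · have h := (hstep (Fin.last m)).1
      rwa [Fin.succ_last, hlast] at h
    · exact hstep i.castSucc
    · rw [← hlast, Fin.snoc_init_self]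
  · rintro ⟨ν, ⟨hcard, hlt⟩, d, ⟨h0, hlast, hstep⟩, rfl⟩
    refine ⟨?_, ?_, fun i => ?_⟩
    · rw [← Fin.castSucc_zero, Fin.snoc_castSucc, h0]
    · rw [Fin.snoc_last]
    · refine Fin.lastCases ?_ (fun i => ?_) i
      · rw [Fin.succ_last, Fin.snoc_last, Fin.snoc_castSucc, hlast, hμ, hcard]
        exact ⟨hlt, rfl⟩
      · rw [Fin.succ_castSucc, Fin.snoc_castSucc, Fin.snoc_castSucc]
        exact hstep i

theorem finite_saturatedChains {m : ℕ} {μ : YoungDiagram} (hμ : μ.card = m) :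
    (saturatedChains m μ).Finite := by
  classical
  induction m generalizing μ with
  | zero =>
    refine (Set.finite_singleton fun _ => ⊥).subset fun c hc => ?_
    funext i
    rw [Fin.fin_one_eq_zero i]
    exact hc.1
  | succ m ih =>
    rw [saturatedChains_succ hμ]
    refine (Finset.finite_toSet _).biUnion fun ν hν => Set.Finite.image _ (ih ?_)
    exact mem_partitionsOf.1 (Finset.mem_filter.1 hν).1

theorem numStandardTableaux_of_card_eq_zero {μ : YoungDiagram} (hμ : μ.card = 0) :
    numStandardTableaux μ = 1 := by
  have hbot : μ = ⊥ := YoungDiagram.ext (by simpa using Finset.card_eq_zero.1 hμ)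
  rw [numStandardTableaux_eq_ncard hμ, Set.ncard_eq_one]
  refine ⟨fun _ => ⊥, Set.eq_singleton_iff_unique_mem.2 ⟨⟨rfl, hbot.symm, fun i => i.elim0⟩, ?_⟩⟩
  intro c hc
  funext i
  rw [Fin.fin_one_eq_zero i]
  exact hc.1

open scoped Classical in
/-- Removing the largest entry of a standard Young tableau. -/
theorem numStandardTableaux_eq_sum {μ : YoungDiagram} {n : ℕ} (hμ : μ.card = n + 1) :
    numStandardTableaux μ = ∑ ν ∈ partitionsOf n with ν < μ, numStandardTableaux ν := by
  rw [numStandardTableaux_eq_ncard hμ, saturatedChains_succ hμ]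
  have hunion := (Finset.finite_toSet ((partitionsOf n).filter (· < μ))).ncard_biUnion
    (s := fun ν => (fun c : Fin (n + 1) → YoungDiagram =>
      (Fin.snoc c μ : Fin (n + 2) → YoungDiagram)) '' saturatedChains n ν)
    (fun ν hν => (finite_saturatedChains
      (mem_partitionsOf.1 (Finset.mem_filter.1 hν).1)).image _) ?_
  · simp only [Finset.mem_coe] at hunion
    rw [hunion, finsum_mem_finset_eq_sum]
    refine Finset.sum_congr rfl fun ν hν => ?_
    rw [Set.ncard_image_of_injective _ (Fin.snoc_left_injective (α := fun _ => YoungDiagram) μ),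
      numStandardTableaux_eq_ncard (mem_partitionsOf.1 (Finset.mem_filter.1 hν).1)]
  · intro ν _ ν' _ hne
    refine Set.disjoint_left.2 ?_
    rintro _ ⟨c, hc, rfl⟩ ⟨c', hc', heq⟩
    rw [Fin.snoc_left_injective (α := fun _ => YoungDiagram) μ heq] at hc'
    exact hne (hc.2.1.symm.trans hc'.2.1)

/-- Expansion of `h_1 ^ n` in Schur functions. -/
theorem sum_numStandardTableaux_mul_schurValue {R : Type*} [CommRing R] {H : ℤ → R}
    (hneg : ∀ m < 0, H m = 0) (hzero : H 0 = 1) (n : ℕ) :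
    ∑ μ ∈ partitionsOf n, (numStandardTableaux μ : R) * schurValue H μ = H 1 ^ n := by
  classical
  induction n with
  | zero =>
    have hbot : partitionsOf 0 = {⊥} := by
      ext μ
      rw [mem_partitionsOf, Finset.mem_singleton]
      refine ⟨fun h => YoungDiagram.ext (by simpa using Finset.card_eq_zero.1 h), ?_⟩
      rintro rfl
      exact Finset.card_empty
    have hcard : (⊥ : YoungDiagram).card = 0 := Finset.card_empty
    simp [hbot, numStandardTableaux_of_card_eq_zero hcard, schurValue_of_card_eq_zero H hcard]
  | succ n ih =>
    calc ∑ μ ∈ partitionsOf (n + 1), (numStandardTableaux μ : R) * schurValue H μ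
        = ∑ μ ∈ partitionsOf (n + 1), ∑ ν ∈ partitionsOf n with ν < μ,
            (numStandardTableaux ν : R) * schurValue H μ := by
          refine Finset.sum_congr rfl fun μ hμ => ?_
          rw [numStandardTableaux_eq_sum (mem_partitionsOf.1 hμ), Nat.cast_sum, Finset.sum_mul]
      _ = ∑ ν ∈ partitionsOf n, ∑ μ ∈ partitionsOf (n + 1) with ν < μ,
            (numStandardTableaux ν : R) * schurValue H μ :=
          Finset.sum_comm' fun μ ν => by simp only [Finset.mem_filter]; tauto
      _ = ∑ ν ∈ partitionsOf n, H 1 * ((numStandardTableaux ν : R) * schurValue H ν) := by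
          refine Finset.sum_congr rfl fun ν hν => ?_
          rw [← Finset.mul_sum, sum_schurValue_covers hneg hzero (mem_partitionsOf.1 hν),
            mul_left_comm]
      _ = H 1 ^ (n + 1) := by rw [← Finset.mul_sum, ih, pow_succ']

end Tableaux

/-! ### Extension of sequences by zero -/

section ZeroExtension

variable {R : Type*} [Zero R]

/-- The extension of a sequence by zero to negative indices. -/
def extendByZero (h : ℕ → R) (m : ℤ) : R := if m < 0 then 0 else h m.toNat

theorem extendByZero_of_neg (h : ℕ → R) {m : ℤ} (hm : m < 0) : extendByZero h m = 0 := if_pos hm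

@[simp]
theorem extendByZero_natCast (h : ℕ → R) (m : ℕ) : extendByZero h (m : ℤ) = h m := by
  simp [extendByZero]

end ZeroExtension

/-! ### Frobenius' formula for the number of tableaux -/

section Frobenius

/-- The sequence `1 / m!`, the exponential specialization of the complete homogeneous symmetric
functions. -/
noncomputable def invFactorial : ℤ → ℝ := extendByZero fun m => ((m.factorial : ℝ))⁻¹

theorem invFactorial_of_neg (m : ℤ) (hm : m < 0) : invFactorial m = 0 :=
  extendByZero_of_neg _ hm

theorem invFactorial_natCast (m : ℕ) : invFactorial m = (m.factorial : ℝ)⁻¹ :=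
  extendByZero_natCast _ m

theorem invFactorial_zero : invFactorial 0 = 1 := by
  simpa using invFactorial_natCast 0

theorem invFactorial_one : invFactorial 1 = 1 := by
  simpa using invFactorial_natCast 1

theorem invFactorial_sub_one (m : ℤ) : invFactorial (m - 1) = m * invFactorial m := by
  rcases lt_trichotomy m 0 with hm | rfl | hm
  · rw [invFactorial_of_neg _ hm, invFactorial_of_neg _ (by omega), mul_zero]
  · rw [invFactorial_of_neg _ (by omega), Int.cast_zero, zero_mul]
  · obtain ⟨k, rfl⟩ : ∃ k : ℕ, m = ((k + 1 : ℕ) : ℤ) := ⟨(m - 1).toNat, by omega⟩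
    have hk : ((k + 1 : ℕ) : ℤ) - 1 = (k : ℤ) := by push_cast; ring
    rw [hk, invFactorial_natCast, invFactorial_natCast, Nat.factorial_succ]
    have : ((k + 1 : ℕ) : ℝ) ≠ 0 := Nat.cast_ne_zero.2 k.succ_ne_zero
    push_cast at this ⊢
    field_simp

/-- Frobenius' determinantal formula for the number of standard Young tableaux. -/
theorem numStandardTableaux_eq_factorial_mul {μ : YoungDiagram} {n : ℕ} (hμ : μ.card = n) :
    (numStandardTableaux μ : ℝ) = n.factorial * schurValue invFactorial μ := by
  classical
  induction n generalizing μ with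
  | zero => simp [numStandardTableaux_of_card_eq_zero hμ, schurValue_of_card_eq_zero _ hμ]
  | succ n ih =>
    rw [numStandardTableaux_eq_sum hμ, Nat.cast_sum, Finset.sum_congr rfl fun ν hν =>
      ih (mem_partitionsOf.1 (Finset.mem_filter.1 hν).1), ← Finset.mul_sum,
      sum_schurValue_coveredBy invFactorial_of_neg invFactorial_zero
        invFactorial_sub_one hμ, Nat.factorial_succ]
    push_cast
    ring

end Frobenius

/-! ### Degree vectors -/

section DegreeVectors

theorem degreeVector_strictMono (μ : YoungDiagram) : StrictMono (degreeVector μ) := by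
  intro i j hij
  have h := μ.rowLen_anti (partitionLength μ - 1 - j) (partitionLength μ - 1 - i)
    (by have := Fin.lt_def.1 hij; omega)
  have := Fin.lt_def.1 hij
  simp only [degreeVector]
  omega

/-- The Jacobi–Trudi determinant in terms of the degree vector: both the rows and the columns
are listed in reverse. -/
theorem det_degreeVector_eq_schurValue {R : Type*} [CommRing R] (H : ℤ → R) (μ : YoungDiagram) :
    (Matrix.of fun i j : Fin (partitionLength μ) => H ((degreeVector μ i : ℤ) - (j : ℕ))).det =
      schurValue H μ := by
  rw [schurValue, jacobiTrudi, ← Matrix.det_submatrix_equiv_self Fin.revPerm]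
  congr 1
  ext i j
  have hi := i.2
  have hj := j.2
  simp only [Matrix.submatrix_apply, Matrix.of_apply, Fin.revPerm_apply, degreeVector,
    Fin.val_rev]
  have hrow : partitionLength μ - 1 - (partitionLength μ - (i + 1)) = i := by omega
  rw [hrow]
  congr 1
  push_cast [Nat.sub_add_eq]
  omega

theorem det_vandermonde_degreeVector (μ : YoungDiagram) :
    (Matrix.vandermonde fun i => (degreeVector μ i : ℝ)).det =
      (∏ i, ((degreeVector μ i).factorial : ℝ)) * schurValue invFactorial μ := by
  rw [Matrix.det_eval_matrixOfPolynomials_eq_det_vandermonde _ (fun j => descPochhammer ℝ j)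
    (fun j => descPochhammer_natDegree ℝ j) (fun j => monic_descPochhammer ℝ j),
    ← det_degreeVector_eq_schurValue, ← Matrix.det_mul_column]
  congr 1
  ext i j
  simp only [Matrix.of_apply, descPochhammer_eval_eq_descFactorial]
  rcases le_or_gt (j : ℕ) (degreeVector μ i) with h | h
  · rw [← Nat.cast_sub h, invFactorial_natCast, ← Nat.factorial_mul_descFactorial h]
    have := Nat.cast_ne_zero (R := ℝ).2 (Nat.factorial_ne_zero (degreeVector μ i - j))
    push_cast
    field_simp
  · rw [invFactorial_of_neg _ (by omega), mul_zero,
      Nat.descFactorial_of_lt h, Nat.cast_zero]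

theorem schurValue_invFactorial_ne_zero (μ : YoungDiagram) : schurValue invFactorial μ ≠ 0 := by
  have h : (Matrix.vandermonde fun i => (degreeVector μ i : ℝ)).det ≠ 0 :=
    Matrix.det_vandermonde_ne_zero_iff.2
      (Nat.cast_injective.comp (degreeVector_strictMono μ).injective)
  rw [det_vandermonde_degreeVector] at h
  exact right_ne_zero_of_mul h

end DegreeVectors

/-! ### Wronskian Appell polynomials as Schur functions -/

section Appell

/-- The divided Appell sequence `A_m / m!`, extended by zero to negative indices. Differentiation
lowers its index by one. -/
noncomputable def dividedAppell (A : ℕ → ℝ[X]) : ℤ → ℝ[X] :=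
  extendByZero fun m => C ((m.factorial : ℝ))⁻¹ * A m

theorem dividedAppell_of_neg (A : ℕ → ℝ[X]) (m : ℤ) (hm : m < 0) : dividedAppell A m = 0 :=
  extendByZero_of_neg _ hm

theorem dividedAppell_natCast (A : ℕ → ℝ[X]) (m : ℕ) :
    dividedAppell A m = C (m.factorial : ℝ)⁻¹ * A m :=
  extendByZero_natCast _ m

theorem IsAppellSequence.iterate_derivative {A : ℕ → ℝ[X]} (hA : IsAppellSequence A) (n j : ℕ) :
    derivative^[j] (A n) = C (n.factorial : ℝ) * dividedAppell A ((n : ℤ) - j) := by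
  induction j generalizing n with
  | zero =>
    have := Nat.cast_ne_zero (R := ℝ).2 n.factorial_ne_zero
    rw [Function.iterate_zero_apply, Nat.cast_zero, sub_zero, dividedAppell_natCast,
      ← mul_assoc, ← C_mul, mul_inv_cancel₀ this, C_1, one_mul]
  | succ j ih =>
    rw [Function.iterate_succ_apply]
    cases n with
    | zero =>
      rw [hA.zero, derivative_one, iterate_map_zero,
        dividedAppell_of_neg _ _ (by push_cast; omega), mul_zero]
    | succ n =>
      rw [hA.derivative_succ, ← C_eq_natCast, Polynomial.iterate_derivative_C_mul, ih,
        Nat.factorial_succ, ← mul_assoc, ← C_mul]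
      push_cast
      rw [add_sub_add_right_eq_sub]

theorem IsAppellSequence.polynomialWronskian_degreeVector {A : ℕ → ℝ[X]}
    (hA : IsAppellSequence A) (μ : YoungDiagram) :
    polynomialWronskian (fun i => A (degreeVector μ i)) =
      C (∏ i, ((degreeVector μ i).factorial : ℝ)) * schurValue (dividedAppell A) μ := by
  rw [polynomialWronskian, map_prod, ← det_degreeVector_eq_schurValue, ← Matrix.det_mul_column]
  congr 1
  ext1 i j
  exact hA.iterate_derivative _ _

/-- Up to the factor `F_μ / |μ|!`, written here as a Schur function of `1 / m!`, Wronskian Appell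
polynomials are Schur functions. -/
theorem IsAppellSequence.C_mul_wronskianAppell {A : ℕ → ℝ[X]} (hA : IsAppellSequence A)
    (μ : YoungDiagram) :
    C (schurValue invFactorial μ) * wronskianAppell A μ = schurValue (dividedAppell A) μ := by
  have hne := schurValue_invFactorial_ne_zero μ
  have hprod : ∏ i, ((degreeVector μ i).factorial : ℝ) ≠ 0 :=
    Finset.prod_ne_zero_iff.2 fun i _ => Nat.cast_ne_zero.2 (Nat.factorial_ne_zero _)
  rw [wronskianAppell, hA.polynomialWronskian_degreeVector, det_vandermonde_degreeVector,
    ← mul_assoc, ← mul_assoc, ← C_mul, ← C_mul]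
  have hone : schurValue invFactorial μ * ((∏ i, ((degreeVector μ i).factorial : ℝ)) *
      schurValue invFactorial μ)⁻¹ * ∏ i, ((degreeVector μ i).factorial : ℝ) = 1 := by
    field_simp
  rw [hone, C_1, one_mul]

end Appell

/-! ### The Plancherel average -/

theorem plancherelWeight_eq {n : ℕ} {μ : YoungDiagram} (hμ : μ.card = n) :
    plancherelWeight n μ = numStandardTableaux μ * schurValue invFactorial μ := by
  have hn := Nat.cast_ne_zero (R := ℝ).2 n.factorial_ne_zero
  rw [plancherelWeight, pow_two, mul_div_assoc]
  congr 1
  rw [numStandardTableaux_eq_factorial_mul hμ, mul_div_cancel_left₀ _ hn]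

theorem theorem5p2 (A : ℕ → Polynomial ℝ) (hA : IsAppellSequence A) (n : ℕ) :
    (∑ μ ∈ partitionsOf n, plancherelWeight n μ = 1) ∧
      plancherelExpectation n (fun μ => wronskianAppell A μ) = A 1 ^ n := by
  constructor
  · rw [Finset.sum_congr rfl fun μ hμ => plancherelWeight_eq (mem_partitionsOf.1 hμ),
      sum_numStandardTableaux_mul_schurValue invFactorial_of_neg invFactorial_zero,
      invFactorial_one, one_pow]
  · have hzero : dividedAppell A 0 = 1 := by
      simpa [hA.zero] using dividedAppell_natCast A 0
    have hone : dividedAppell A 1 = A 1 := by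
      simpa using dividedAppell_natCast A 1
    rw [plancherelExpectation, ← hone,
      ← sum_numStandardTableaux_mul_schurValue (dividedAppell_of_neg A) hzero]
    refine Finset.sum_congr rfl fun μ hμ => ?_
    rw [plancherelWeight_eq (mem_partitionsOf.1 hμ), C_mul, mul_assoc, hA.C_mul_wronskianAppell,
      C_eq_natCast]
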